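/- Let $X$ be a finite set with a distinguished point $a'$ (the OFF state), with the weighted star metric $d(a,b)=w_a+w_b$ for $a\ne b$, $d(a,a)=0$, where $w_a\ge 0$. Let $0<L$, let $\beta=\max_{a\neq a'}d(a',a)$ (the maximum exists, i.e. $X$ has a point other than $a'$), and assume $\beta<(U-L)/2$. **The problem MAL.** An input consists of a horizon $T$, coefficients $c_a\in[0,1]$ with $c_{a'}=0$, and convex cost functions $f_t^a:[0,1]\to\mathbb R$ ($1\le t\le T$, $a\in X$) with $f_t^{a'}\equiv 0$ and, for $a\neq a'$, $f_t^a(0)=0$ and $L\le \frac{d f_t^a}{dx}\le U$ on $[0,1]$. A solution is a sequence $x_1,\dots,x_T$ of probability vectors on $X$; it is feasible if $\sum_{t=1}^T\sum_{a}c_a x_t^a\ge 1$, and only inputs with a feasible solution are considered. With $x_0=x_{T+1}$ the unit mass at $a'$, its cost is $\sum_{t=1}^T\sum_a f_t^a(x_t^a)+\sum_{t=1}^{T+1}d(x_{t-1},x_t)$, where $d(x,y)$ is the minimal cost of transporting $x$ to $y$ when moving mass $m$ from $a$ to $b$ costs $m\,d(a,b)$. Let $\mathrm{OPT}(I)$ be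 the infimum of the costs of the feasible solutions of the input $I$. **Algorithms.** A (deterministic) learning-augmented online algorithm receives $T$, $c$ and an advice $\mathrm{ADV}$ (a feasible solution), and outputs a feasible solution whose decision at time $t$ depends on the cost functions only through those of times $1,\dots,t$. It is $b$-consistent if on every input and for every advice its cost is at most $b$ times the cost of the advice, and $r$-robust if on every input $I$ and for every advice its cost is at most $r\cdot\mathrm{OPT}(I)$. **Statement.** For every $\epsilon\ge 0$ there is exactly one $\gamma=\gamma^\epsilon$ with $\frac{U}{U-2\beta}<\gamma\le\frac UL$ and $$\gamma=\epsilon+\frac UL-\frac{\gamma}{L}(U-L)\ln\!\left(\frac{U-L-2\beta}{U-U/\gamma-2\beta}\right),$$ and every $(1+\epsilon)$-consistent learning-augmented online algorithm for MAL is at least $\gamma^\epsilon$-robust: if it is $r$-robust, then $r\ge\gamma^\epsilon$. -/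

import Mathlib

namespace MAL

/-- The distance of the weighted star with edge weights `w` (the points of `X` are the leaves). -/
noncomputable def starDist {X : Type*} [DecidableEq X] (w : X → ℝ) (a b : X) : ℝ :=
  if a = b then 0 else w a + w b

/-- Allocations of one unit of the resource to the points of `X`: the unit simplex. -/
def IsAllocation {X : Type*} [Fintype X] (x : X → ℝ) : Prop :=
  (∀ a, 0 ≤ x a) ∧ ∑ a, x a = 1

/-- Switching cost between two allocations: moving a mass `m` from `a` to `b` costs `m * d a b`,
and the mass is moved as cheaply as possible. -/
noncomputable def switchCost {X : Type*} [Fintype X] (d : X → X → ℝ) (x y : X → ℝ) : ℝ :=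
  sInf {s : ℝ | ∃ π : X → X → ℝ, (∀ a b, 0 ≤ π a b) ∧ (∀ a, ∑ b, π a b = x a) ∧
    (∀ b, ∑ a, π a b = y b) ∧ s = ∑ a, ∑ b, π a b * d a b}

/-- The data of an input sequence: the horizon `T`, the coefficients `c` of the long-term
constraint, and the cost functions `f t a`, of which only the values on `[0,1]` matter. -/
structure Instance (X : Type*) where
  T : ℕ
  c : X → ℝ
  f : Fin T → X → ℝ → ℝ

/-- The offline feasible solutions: one allocation per time step, satisfying the long-term
constraint. -/
def Feasible {X : Type*} [Fintype X] (I : Instance X) (x : Fin I.T → X → ℝ) : Prop :=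
  (∀ t, IsAllocation (x t)) ∧ 1 ≤ ∑ t, ∑ a, I.c a * x t a

/-- Valid inputs of the problem with `OFF` state `off` and slope bounds `L`, `U`, among them that
the long-term constraint can be satisfied at all. -/
structure IsValid {X : Type*} [Fintype X] (off : X) (L U : ℝ) (I : Instance X) : Prop where
  c_mem : ∀ a, I.c a ∈ Set.Icc (0 : ℝ) 1
  c_off : I.c off = 0
  f_off : ∀ t, ∀ x ∈ Set.Icc (0 : ℝ) 1, I.f t off x = 0
  f_convex : ∀ t a, ConvexOn ℝ (Set.Icc 0 1) (I.f t a)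
  f_zero : ∀ t a, I.f t a 0 = 0
  f_slope : ∀ t, ∀ a ≠ off, ∀ x ∈ Set.Icc (0 : ℝ) 1,
    ∃ m ∈ Set.Icc L U, HasDerivWithinAt (I.f t a) m (Set.Icc 0 1) x
  feasible : ∃ x, Feasible I x

/-- The trajectory of the player: it starts in the `OFF` state, follows the `T` decisions, and is
in the `OFF` state again from time `T + 1` on. -/
noncomputable def trajectory {X : Type*} [DecidableEq X] (off : X) {T : ℕ}
    (x : Fin T → X → ℝ) : ℕ → X → ℝ
  | 0 => Pi.single off 1
  | t + 1 => if h : t < T then x ⟨t, h⟩ else Pi.single off 1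

/-- Total cost of a sequence of decisions: hitting costs, plus the switching costs of the `T + 1`
moves of the trajectory. -/
noncomputable def cost {X : Type*} [Fintype X] [DecidableEq X] (w : X → ℝ) (off : X)
    (I : Instance X) (x : Fin I.T → X → ℝ) : ℝ :=
  (∑ t, ∑ a, I.f t a (x t a)) +
    ∑ t ∈ Finset.range (I.T + 1),
      switchCost (starDist w) (trajectory off x t) (trajectory off x (t + 1))

/-- The optimal offline cost. -/
noncomputable def opt {X : Type*} [Fintype X] [DecidableEq X] (w : X → ℝ) (off : X)
    (I : Instance X) : ℝ :=
  sInf (cost w off I '' {x | Feasible I x})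

/-- A map that turns an input sequence and an advice (a sequence of decisions) into a sequence of
decisions. -/
abbrev Strategy (X : Type*) : Type _ :=
  (I : Instance X) → (Fin I.T → X → ℝ) → (Fin I.T → X → ℝ)

/-- Deterministic learning-augmented online algorithms. The decision at time `t` depends on the
horizon, the constraint, the advice, and the cost functions revealed up to and including time `t`.
An algorithm to which also the advice is only revealed step by step is a special case. -/
structure IsOnlineAlgorithm {X : Type*} [Fintype X] (off : X) (L U : ℝ)
    (A : Strategy X) : Prop where
  feasible : ∀ I, IsValid off L U I → ∀ adv, Feasible I adv → Feasible I (A I adv)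
  causal : ∀ (T : ℕ) (c : X → ℝ) (f f' : Fin T → X → ℝ → ℝ),
    IsValid off L U ⟨T, c, f⟩ → IsValid off L U ⟨T, c, f'⟩ →
    ∀ adv : Fin T → X → ℝ, Feasible ⟨T, c, f⟩ adv →
    ∀ t : Fin T, (∀ s ≤ t, f s = f' s) → A ⟨T, c, f⟩ adv t = A ⟨T, c, f'⟩ adv t

/-- `b`-consistency: `b`-competitive with respect to the advice. -/
def IsConsistent {X : Type*} [Fintype X] [DecidableEq X] (w : X → ℝ) (off : X) (L U : ℝ)
    (A : Strategy X) (b : ℝ) : Prop :=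
  ∀ I, IsValid off L U I → ∀ adv, Feasible I adv →
    cost w off I (A I adv) ≤ b * cost w off I adv

/-- `r`-robustness: `r`-competitive with respect to the offline optimum, whatever the advice. -/
def IsRobust {X : Type*} [Fintype X] [DecidableEq X] (w : X → ℝ) (off : X) (L U : ℝ)
    (A : Strategy X) (r : ℝ) : Prop :=
  ∀ I, IsValid off L U I → ∀ adv, Feasible I adv →
    cost w off I (A I adv) ≤ r * opt w off I

/-- `γ` is the target robustness factor for `ε`. The lower bound on `γ` says that the logarithm is
taken of a positive number; the equation may have a second, irrelevant solution above `U / L`. -/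
def IsTargetRobustness (L U β ε γ : ℝ) : Prop :=
  U / (U - 2 * β) < γ ∧ γ ≤ U / L ∧
    γ = ε + U / L - γ / L * (U - L) * Real.log ((U - L - 2 * β) / (U - U / γ - 2 * β))

end MAL

namespace MAL

open Finset

/-! Let `pt` be a point at distance `β` from OFF. The adversary uses linear costs: slope `p t ∈ [L,
U]` at `pt` and slope `U` at the other points besides OFF, and only mass at `pt` counts for the
constraint. The advice buys one unit during the last `N` steps. If these are offered at price `L`,
consistency allows an expense of at most `ε L + O(1/N)` in excess of `L`.

Before that, the price drops from `U / r` to `L` by small levels, in bursts of at most `N` steps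
separated by long rests at price `U`. After a full burst at price `x` the price might stay at `U`
forever; then `OPT ≤ x + 2β/N`, and `r`-robustness forces a net gain of about `U - r x` over buying
everything at `U`. A unit bought at `x`, with its way to `pt` and back, gains `U - x - 2β` against
price `U` and loses `x - L + 2β` against price `L`; the quotient is `rate`. Summing by parts over
the levels, the forced loss is `r ∫ rate` over `[L, U/r]`, which is `excess r`. Hence `excess r ≤ ε
L`, and since `excess` is strictly decreasing with value `ε L` at `γ`, no `r < γ` is possible.

The player could try to save movement in two ways. Waiting outside OFF during the rests is limited,
because occupied mass costs at least `L` per step and the total cost is bounded. Holding mass at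
`pt` for several steps of a burst is defeated by ending the burst at the first purchase that dwarfs
the earlier ones (`IsReaction.exists_burst`); boundedness of the occupied mass makes such
interruptions finite in number (`IsReaction.exists_level`). `IsReaction.exists_levels` performs the
summation, and `excess_le_of_isRobust` applies it to an algorithm and lets `N → ∞`. -/

/-! ### The equation for the target robustness. -/

/-- The excess of the consistency bound that `γ`-robustness forces, normalised so that the equation
for the target robustness reads `excess L U β γ = ε * L`. -/
noncomputable def excess (L U β γ : ℝ) : ℝ :=
  γ * (U - L) * Real.log ((U - L - 2 * β) / (U - U / γ - 2 * β)) + γ * L - U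

/-- Put `q = U - U / r - 2 * β`. Applying `log z ≤ z - 1` to `q₁ / q₂` and to `A / q₂` shows that
the logarithmic term drops by more than `(r₂ - r₁) (U - L) L / q₂`. This pays for the increase `(r₂
- r₁) L` of the linear term because `q₂ ≤ A ≤ U - L`. -/
theorem excess_strictAntiOn {L U β : ℝ} (hL : 0 < L) (hβ : 0 ≤ β) (hβU : 2 * β < U - L) :
    StrictAntiOn (excess L U β) (Set.Ioc (U / (U - 2 * β)) (U / L)) := by
  rintro r₁ ⟨h₁, -⟩ r₂ ⟨-, h₂⟩ h
  have hS : 0 < U - 2 * β := by linarith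
  have hU : 0 < U := by linarith
  have hr₁ : 0 < r₁ := (div_pos hU hS).trans h₁
  have hr₂ : 0 < r₂ := hr₁.trans h
  obtain ⟨q₁, hq₁⟩ : ∃ q, q = U - U / r₁ - 2 * β := ⟨_, rfl⟩
  obtain ⟨q₂, hq₂⟩ : ∃ q, q = U - U / r₂ - 2 * β := ⟨_, rfl⟩
  obtain ⟨A, hA⟩ : ∃ q, q = U - L - 2 * β := ⟨_, rfl⟩
  have hq₁pos : 0 < q₁ := by
    have : U / r₁ < U - 2 * β := by
      rw [div_lt_iff₀ hr₁, mul_comm]; rwa [div_lt_iff₀ hS] at h₁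
    linarith
  have hq : q₁ < q₂ := by
    have : U / r₂ < U / r₁ := div_lt_div_of_pos_left hU hr₁ h
    linarith
  have hq₂pos : 0 < q₂ := hq₁pos.trans hq
  have hqA : q₂ ≤ A := by
    have : L ≤ U / r₂ := by
      rw [le_div_iff₀ hr₂, mul_comm]; rwa [le_div_iff₀ hL] at h₂
    linarith
  have hApos : 0 < A := hq₂pos.trans_le hqA
  have hl₁ : Real.log (A / q₁) - Real.log (A / q₂) > (q₂ - q₁) / q₂ := by
    have h3 := Real.log_lt_sub_one_of_pos (div_pos hq₁pos hq₂pos)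
      (by rw [ne_eq, div_eq_one_iff_eq hq₂pos.ne']; exact hq.ne)
    rw [Real.log_div hq₁pos.ne' hq₂pos.ne'] at h3
    rw [Real.log_div hApos.ne' hq₁pos.ne', Real.log_div hApos.ne' hq₂pos.ne']
    have : (q₂ - q₁) / q₂ = 1 - q₁ / q₂ := by field_simp
    linarith
  have hl₂ : Real.log (A / q₂) ≤ A / q₂ - 1 := Real.log_le_sub_one_of_pos (div_pos hApos hq₂pos)
  have e₁ : r₁ * ((q₂ - q₁) / q₂) = (r₂ - r₁) * (U / r₂ / q₂) := by
    have : q₂ - q₁ = U / r₁ - U / r₂ := by rw [hq₁, hq₂]; ring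
    rw [this]; field_simp
  have e₂ : U / r₂ / q₂ - (A / q₂ - 1) = L / q₂ := by
    have : U / r₂ = L + A - q₂ := by rw [hq₂, hA]; ring
    rw [this]; field_simp; ring
  have k₁ : r₁ * ((q₂ - q₁) / q₂) < r₁ * (Real.log (A / q₁) - Real.log (A / q₂)) :=
    mul_lt_mul_of_pos_left hl₁ hr₁
  have k₂ : (r₂ - r₁) * Real.log (A / q₂) ≤ (r₂ - r₁) * (A / q₂ - 1) :=
    mul_le_mul_of_nonneg_left hl₂ (by linarith)
  have k₃ : (r₂ - r₁) * (L / q₂) < r₁ * Real.log (A / q₁) - r₂ * Real.log (A / q₂) := by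
    rw [← e₂]; linarith
  have k₄ : L ≤ (U - L) * (L / q₂) := by
    rw [mul_div_assoc', le_div_iff₀ hq₂pos, mul_comm]
    exact mul_le_mul_of_nonneg_right (by linarith) hL.le
  have k₅ : (r₂ - r₁) * L ≤ (r₂ - r₁) * ((U - L) * (L / q₂)) :=
    mul_le_mul_of_nonneg_left k₄ (by linarith)
  have k₆ := mul_lt_mul_of_pos_left k₃ (show 0 < U - L by linarith)
  unfold excess
  rw [← hq₁, ← hq₂, ← hA]
  linarith

theorem isTargetRobustness_iff {L U β ε γ : ℝ} (hL : 0 < L) :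
    IsTargetRobustness L U β ε γ ↔
      γ ∈ Set.Ioc (U / (U - 2 * β)) (U / L) ∧ excess L U β γ = ε * L := by
  unfold IsTargetRobustness excess
  rw [Set.mem_Ioc, and_assoc]
  refine and_congr_right fun _ => and_congr_right fun _ => ?_
  generalize Real.log _ = l
  constructor
  · intro h
    have h2 : γ * L = (ε + U / L - γ / L * (U - L) * l) * L := by rw [← h]
    field_simp at h2
    linarith
  · intro h
    field_simp
    linarith

theorem existsUnique_isTargetRobustness {L U β ε : ℝ} (hL : 0 < L) (hβ : 0 ≤ β)
    (hβU : 2 * β < U - L) (hε : 0 ≤ ε) : ∃! γ, IsTargetRobustness L U β ε γ := by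
  simp only [isTargetRobustness_iff hL]
  have hS : 0 < U - 2 * β := by linarith
  have hU : 0 < U := by linarith
  have hA : 0 < U - L - 2 * β := by linarith
  have hUL : 0 < U - L := by linarith
  -- With `k` as value of the logarithm, the logarithmic term of `excess` is `r * (U + ε * L)`,
  -- which suffices since `r ≥ 1`; `q` and `r` are solved from this. At the other end `U / L` the
  -- excess is `0`.
  obtain ⟨k, hk⟩ : ∃ k, k = (U + ε * L) / (U - L) := ⟨_, rfl⟩
  have hkpos : 0 < k := by rw [hk]; positivity
  obtain ⟨q, hq⟩ : ∃ q, q = (U - L - 2 * β) * Real.exp (-k) := ⟨_, rfl⟩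
  have hqpos : 0 < q := by rw [hq]; positivity
  have hqA : q < U - L - 2 * β := by
    rw [hq]
    exact mul_lt_of_lt_one_right hA (by rw [Real.exp_lt_one_iff]; linarith)
  have hSq : 0 < U - 2 * β - q := by linarith
  obtain ⟨r, hr⟩ : ∃ r, r = U / (U - 2 * β - q) := ⟨_, rfl⟩
  have hr1 : 1 ≤ r := by rw [hr, one_le_div hSq]; linarith
  have hrl : U / (U - 2 * β) < r := by
    rw [hr]; exact div_lt_div_of_pos_left hU hSq (by linarith)
  have hru : r ≤ U / L := by
    rw [hr]; exact div_le_div_of_nonneg_left hU.le hL (by linarith)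
  have hUr : U - U / r - 2 * β = q := by
    rw [hr, div_div_cancel₀ hU.ne']; ring
  have hlog : Real.log ((U - L - 2 * β) / q) = k := by
    rw [hq, Real.log_div hA.ne' (by positivity), Real.log_mul hA.ne' (by positivity),
      Real.log_exp]
    ring
  have hlow : ε * L ≤ excess L U β r := by
    unfold excess
    rw [hUr, hlog]
    have e1 : (U - L) * k = U + ε * L := by rw [hk]; field_simp
    have : U + ε * L ≤ r * (U + ε * L) := le_mul_of_one_le_left (by positivity) hr1
    have h3 : 0 < r * L := by positivity
    rw [mul_assoc, e1]; linarith
  have hhigh : excess L U β (U / L) ≤ ε * L := by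
    unfold excess
    rw [div_div_cancel₀ hU.ne', div_self hA.ne', Real.log_one, div_mul_cancel₀ _ hL.ne']
    have : 0 ≤ ε * L := by positivity
    linarith
  have hcont : ContinuousOn (excess L U β) (Set.Icc r (U / L)) := by
    unfold excess
    have hne : ∀ x ∈ Set.Icc r (U / L), U - U / x - 2 * β ≠ 0 := by
      intro x hx
      have : U / x ≤ U / r := div_le_div_of_nonneg_left hU.le (by linarith) hx.1
      have : 0 < U - U / x - 2 * β := by linarith
      exact this.ne'
    have hx0 : ∀ x ∈ Set.Icc r (U / L), x ≠ 0 := fun x hx => by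
      have := hx.1
      intro h; linarith
    have hdiv : ContinuousOn (fun x : ℝ => U - U / x - 2 * β) (Set.Icc r (U / L)) :=
      (continuousOn_const.sub (continuousOn_const.div continuousOn_id hx0)).sub continuousOn_const
    refine ContinuousOn.sub (ContinuousOn.add (ContinuousOn.mul (by fun_prop) ?_)
      (by fun_prop)) (by fun_prop)
    exact ContinuousOn.log (continuousOn_const.div hdiv hne)
      fun x hx => div_ne_zero hA.ne' (hne x hx)
  obtain ⟨γ, hγ, hγe⟩ := intermediate_value_Icc' hru hcont ⟨hhigh, hlow⟩
  have hmem : γ ∈ Set.Ioc (U / (U - 2 * β)) (U / L) := ⟨hrl.trans_le hγ.1, hγ.2⟩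
  exact ⟨γ, ⟨hmem, hγe⟩, fun y hy =>
    (excess_strictAntiOn hL hβ hβU).injOn hy.1 hmem (hy.2.trans hγe.symm)⟩

/-! ### Net gain, net loss and causal reactions to prices. -/

/-- The total upward movement of `φ` during the first `t` steps. -/
noncomputable def climb (φ : ℕ → ℝ) (t : ℕ) : ℝ :=
  ∑ s ∈ range t, max (φ (s + 1) - φ s) 0

theorem climb_add (φ : ℕ → ℝ) (t k : ℕ) :
    climb φ t + max 0 (φ (t + k) - φ t) ≤ climb φ (t + k) := by
  induction k with
  | zero => simp
  | succ k ih =>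
    have h : climb φ (t + (k + 1)) = climb φ (t + k) + max (φ (t + k + 1) - φ (t + k)) 0 := by
      simp [climb, ← add_assoc, sum_range_succ]
    rw [h, ← add_assoc t k 1]
    have h1 := le_max_left (φ (t + k + 1) - φ (t + k)) 0
    have h2 := le_max_right (φ (t + k + 1) - φ (t + k)) 0
    have h3 := le_max_left 0 (φ (t + k) - φ t)
    have h4 := le_max_right 0 (φ (t + k) - φ t)
    rcases max_cases 0 (φ (t + k + 1) - φ t) with h5 | h5 <;> linarith

theorem climb_mono (φ : ℕ → ℝ) {t t' : ℕ} (h : t ≤ t') : climb φ t ≤ climb φ t' := by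
  obtain ⟨k, rfl⟩ := Nat.exists_eq_add_of_le h
  have := climb_add φ t k
  have := le_max_left 0 (φ (t + k) - φ t)
  linarith

theorem sub_le_climb_sub (φ : ℕ → ℝ) {t t' : ℕ} (h : t ≤ t') :
    φ t' - φ t ≤ climb φ t' - climb φ t := by
  obtain ⟨k, rfl⟩ := Nat.exists_eq_add_of_le h
  have := climb_add φ t k
  have := le_max_right 0 (φ (t + k) - φ t)
  linarith

/-- The saving, net of movement, of buying `a (s + 1)` at price `p s` instead of at price `U`. -/
noncomputable def netGain (U : ℝ) (p a φ : ℕ → ℝ) (t : ℕ) : ℝ :=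
  (∑ s ∈ range t, (U - p s) * a (s + 1)) - 2 * climb φ t

/-- The extra expense, including movement, of buying `a (s + 1)` at price `p s` instead of at
price `L`. -/
noncomputable def netLoss (L : ℝ) (p a φ : ℕ → ℝ) (t : ℕ) : ℝ :=
  (∑ s ∈ range t, (p s - L) * a (s + 1)) + 2 * climb φ t

/-- The total occupied mass during the first `t` steps. -/
noncomputable def occupancy (n : ℕ → ℝ) (t : ℕ) : ℝ :=
  ∑ s ∈ range t, n (s + 1)

/-- Price sequences with values in `[L, U]`. -/
def IsPrice (L U : ℝ) (p : ℕ → ℝ) : Prop := ∀ s, p s ∈ Set.Icc L U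

/-- Causal reactions to price sequences: `a` is the purchased amount, `n` the occupied mass, and
`φ` a potential of the position. The position at time `s` depends on the prices before `s`. -/
structure IsReaction (L U β : ℝ) (a n φ : (ℕ → ℝ) → ℕ → ℝ) : Prop where
  nonneg : ∀ p s, IsPrice L U p → 0 ≤ a p s
  le : ∀ p s, IsPrice L U p → a p s ≤ n p s
  lower : ∀ p s, IsPrice L U p → β * a p s ≤ φ p s
  upper : ∀ p s, IsPrice L U p → φ p s ≤ β * n p s
  causal : ∀ p p' s, IsPrice L U p → IsPrice L U p' → (∀ u < s, p u = p' u) →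
    a p s = a p' s ∧ n p s = n p' s ∧ φ p s = φ p' s

theorem climb_congr {φ φ' : ℕ → ℝ} {t : ℕ} (h : ∀ s ≤ t, φ s = φ' s) :
    climb φ t = climb φ' t := by
  refine sum_congr rfl fun s hs => ?_
  have := mem_range.1 hs
  rw [h (s + 1) (by omega), h s (by omega)]

section Reaction

variable {L U β : ℝ} {a n φ : (ℕ → ℝ) → ℕ → ℝ}

/-- Causality lets the adversary fix the later prices after seeing the gain made so far. -/
theorem IsReaction.netGain_congr (H : IsReaction L U β a n φ) {p p' : ℕ → ℝ}
    (hp : IsPrice L U p) (hp' : IsPrice L U p') {t : ℕ} (h : ∀ s < t, p s = p' s) :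
    netGain U p (a p) (φ p) t = netGain U p' (a p') (φ p') t := by
  unfold netGain
  rw [climb_congr fun s hs => (H.causal p p' s hp hp' fun u hu => h u (by omega)).2.2]
  congr 1
  refine sum_congr rfl fun s hs => ?_
  have := mem_range.1 hs
  rw [h s this, (H.causal p p' (s + 1) hp hp' fun u hu => h u (by omega)).1]

theorem IsReaction.netLoss_congr (H : IsReaction L U β a n φ) {p p' : ℕ → ℝ}
    (hp : IsPrice L U p) (hp' : IsPrice L U p') {t : ℕ} (h : ∀ s < t, p s = p' s) :
    netLoss L p (a p) (φ p) t = netLoss L p' (a p') (φ p') t := by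
  unfold netLoss
  rw [climb_congr fun s hs => (H.causal p p' s hp hp' fun u hu => h u (by omega)).2.2]
  congr 1
  refine sum_congr rfl fun s hs => ?_
  have := mem_range.1 hs
  rw [h s this, (H.causal p p' (s + 1) hp hp' fun u hu => h u (by omega)).1]

theorem IsReaction.occupancy_congr (H : IsReaction L U β a n φ) {p p' : ℕ → ℝ}
    (hp : IsPrice L U p) (hp' : IsPrice L U p') {t : ℕ} (h : ∀ s < t, p s = p' s) :
    occupancy (n p) t = occupancy (n p') t := by
  refine sum_congr rfl fun s hs => ?_
  have := mem_range.1 hs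
  rw [(H.causal p p' (s + 1) hp hp' fun u hu => h u (by omega)).2.1]

theorem IsReaction.occupancy_nonneg (H : IsReaction L U β a n φ) {p : ℕ → ℝ}
    (hp : IsPrice L U p) (t : ℕ) : 0 ≤ occupancy (n p) t :=
  sum_nonneg fun _ _ => (H.nonneg p _ hp).trans (H.le p _ hp)

/-! ### Bursts at a single price. -/

/-- `p`, with the price `x` during the `j` steps from time `t` on. -/
noncomputable def burst (p : ℕ → ℝ) (t j : ℕ) (x : ℝ) (s : ℕ) : ℝ :=
  if t ≤ s ∧ s < t + j then x else p s

theorem burst_of_lt (p : ℕ → ℝ) {t : ℕ} (j : ℕ) (x : ℝ) {s : ℕ} (h : s < t) :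
    burst p t j x s = p s := if_neg (by omega)

theorem burst_of_ge (p : ℕ → ℝ) {t j : ℕ} (x : ℝ) {s : ℕ} (h : t + j ≤ s) :
    burst p t j x s = p s := if_neg (by omega)

theorem burst_of_mem (p : ℕ → ℝ) {t j : ℕ} (x : ℝ) {s : ℕ} (h : t ≤ s) (h' : s < t + j) :
    burst p t j x s = x := if_pos ⟨h, h'⟩

theorem isPrice_burst {p : ℕ → ℝ} (hp : IsPrice L U p) (t j : ℕ) {x : ℝ}
    (hx : x ∈ Set.Icc L U) : IsPrice L U (burst p t j x) := by
  intro s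
  unfold burst
  split_ifs
  exacts [hx, hp s]

/-- The exchange rate between net gains and net losses at price `x`. -/
noncomputable def rate (L U β x : ℝ) : ℝ := (U - L) / (U - 2 * β - x) - 1

/-- For a purchase `Z` moved at full price, gain and loss are `(U - 2β - x) Z` and `(x - L + 2β) Z`,
in proportion `1 : rate`. A defect `e` in the climb raises the gain by `2e` and lowers the loss by
`2e`, hence the error `2 (1 + rate) e`. Purchases during the rest at price `U` yield no gain and
only add loss. -/
theorem IsReaction.netLoss_burst (H : IsReaction L U β a n φ) {p : ℕ → ℝ} (hp : IsPrice L U p)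
    {t M j : ℕ} (hU : ∀ s, t ≤ s → p s = U) {x e : ℝ} (hx : x ∈ Set.Icc L U)
    (hxU : x < U - 2 * β) (hrate : 0 ≤ rate L U β x) (p' : ℕ → ℝ) (hp' : p' = burst p (t + M) j x)
    (hclimb : β * (∑ u ∈ range j, a p' (t + M + u + 1)) - e ≤
      climb (φ p') (t + M + j) - climb (φ p') t) :
    netLoss L p (a p) (φ p) t +
        rate L U β x * (netGain U p' (a p') (φ p') (t + M + j) - netGain U p (a p) (φ p) t) -
        2 * (1 + rate L U β x) * e ≤
      netLoss L p' (a p') (φ p') (t + M + j) := by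
  have hpv : IsPrice L U p' := hp' ▸ isPrice_burst hp _ _ hx
  have hag : ∀ s < t, p s = p' s := fun s hs => by rw [hp', burst_of_lt _ _ _ (by omega)]
  rw [H.netLoss_congr hp hpv hag, H.netGain_congr hp hpv hag]
  have hpU : ∀ u < M, p' (t + u) = U := fun u hu => by
    rw [hp', burst_of_lt _ _ _ (by omega), hU _ (by omega)]
  have hpx : ∀ u < j, p' (t + M + u) = x := fun u hu => by
    rw [hp', burst_of_mem _ _ (by omega) (by omega)]
  unfold netLoss netGain
  simp only [sum_range_add]
  have e1 : ∑ u ∈ range M, (U - p' (t + u)) * a p' (t + u + 1) = 0 :=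
    sum_eq_zero fun u hu => by rw [hpU u (mem_range.1 hu)]; ring
  have e2 : ∑ u ∈ range j, (U - p' (t + M + u)) * a p' (t + M + u + 1) =
      (U - x) * ∑ u ∈ range j, a p' (t + M + u + 1) := by
    rw [mul_sum]
    exact sum_congr rfl fun u hu => by rw [hpx u (mem_range.1 hu)]
  have e3 : 0 ≤ ∑ u ∈ range M, (p' (t + u) - L) * a p' (t + u + 1) :=
    sum_nonneg fun u hu => mul_nonneg (sub_nonneg.2 (hpv _).1) (H.nonneg _ _ hpv)
  have e4 : ∑ u ∈ range j, (p' (t + M + u) - L) * a p' (t + M + u + 1) =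
      (x - L) * ∑ u ∈ range j, a p' (t + M + u + 1) := by
    rw [mul_sum]
    exact sum_congr rfl fun u hu => by rw [hpx u (mem_range.1 hu)]
  rw [e1, e2, e4]
  generalize ∑ u ∈ range j, a p' (t + M + u + 1) = Z at *
  have hq : (1 + rate L U β x) * (U - 2 * β - x) = U - L := by
    unfold rate
    have : U - 2 * β - x ≠ 0 := by linarith
    field_simp
    ring
  generalize rate L U β x = h at *
  have := mul_le_mul_of_nonneg_left hclimb (show 0 ≤ 1 + h by linarith)
  have hq' : (1 + h) * (U - 2 * β - x) * Z = (U - L) * Z := by rw [hq]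
  linarith

theorem exists_mul_le_sum (f : ℕ → ℝ) {M : ℕ} (hM : 0 < M) :
    ∃ u < M, M * f u ≤ ∑ v ∈ range M, f v := by
  obtain ⟨u, hu, h⟩ := exists_min_image (range M) f ⟨0, mem_range.2 hM⟩
  refine ⟨u, mem_range.1 hu, ?_⟩
  have := card_nsmul_le_sum (range M) f (f u) h
  simpa using this

/-- A discrete Grönwall bound: if no term dwarfs its predecessors, the partial sums grow at most
geometrically from `τ`. -/
theorem sum_le_of_le_mul_sum {f : ℕ → ℝ} {m τ : ℝ} (hm : 1 ≤ m) (hτ : 0 ≤ τ) {K : ℕ}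
    (h : ∀ i < K, f i ≤ m * (∑ u ∈ range i, f u) + τ) :
    ∑ u ∈ range K, f u ≤ τ * (1 + m) ^ K := by
  suffices ∀ i ≤ K, ∑ u ∈ range i, f u + τ ≤ τ * (1 + m) ^ i by
    have := this K le_rfl
    linarith
  intro i
  induction i with
  | zero => simp
  | succ i ih =>
    intro hi
    have h1 := ih (by omega)
    have h2 := h i (by omega)
    rw [sum_range_succ, pow_succ]
    have h3 := mul_le_mul_of_nonneg_right h1 (show 0 ≤ 1 + m by linarith)
    have h4 : τ ≤ m * τ := le_mul_of_one_le_left hτ hm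
    linarith

end Reaction

section Reaction

variable {L U β : ℝ} {a n φ : (ℕ → ℝ) → ℕ → ℝ}

/-- The burst ends at the first purchase exceeding `M` times the earlier ones by more than `τ`. If
there is none, the whole burst buys so little that its movement may be ignored. Otherwise the last
purchase dominates, and it had to be moved in after the rest. -/
theorem IsReaction.exists_burst (H : IsReaction L U β a n φ) (hβ : 0 ≤ β) {p : ℕ → ℝ}
    (hp : IsPrice L U p) {t M K : ℕ} (hM : 0 < M) (hU : ∀ s, t ≤ s → p s = U) {x τ : ℝ}
    (hτ : 0 ≤ τ) (hx : x ∈ Set.Icc L U) (hxU : x < U - 2 * β) (hrate : 0 ≤ rate L U β x) :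
    ∃ j ≤ K, ∃ p', p' = burst p (t + M) j x ∧ ∃ e : ℝ,
      netLoss L p (a p) (φ p) t +
        rate L U β x * (netGain U p' (a p') (φ p') (t + M + j) - netGain U p (a p) (φ p) t) -
        2 * (1 + rate L U β x) * e ≤ netLoss L p' (a p') (φ p') (t + M + j) ∧
      (j = K ∧ e = β * (τ * (1 + M) ^ K) ∨
        τ ≤ occupancy (n p') (t + M + j) - occupancy (n p) t ∧
        e = β * ((occupancy (n p') (t + M + j) - occupancy (n p) t) / M)) := by
  obtain ⟨p₁, hp₁⟩ : ∃ q, q = burst p (t + M) K x := ⟨_, rfl⟩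
  have hp₁v : IsPrice L U p₁ := hp₁ ▸ isPrice_burst hp _ _ hx
  have hM' : (0 : ℝ) < M := by exact_mod_cast hM
  have hM1 : (1 : ℝ) ≤ M := by exact_mod_cast hM
  by_cases hall : ∀ i < K, a p₁ (t + M + i + 1) ≤
      M * (∑ u ∈ range i, a p₁ (t + M + u + 1)) + τ
  · refine ⟨K, le_rfl, p₁, hp₁, β * (τ * (1 + M) ^ K), ?_, Or.inl ⟨rfl, rfl⟩⟩
    refine H.netLoss_burst hp hU hx hxU hrate p₁ hp₁ ?_
    have h1 := sum_le_of_le_mul_sum hM1 hτ hall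
    have h2 := mul_le_mul_of_nonneg_left h1 hβ
    have h3 := climb_mono (φ p₁) (show t ≤ t + M + K by omega)
    linarith
  · push Not at hall
    obtain ⟨i, hi, hai⟩ := hall
    obtain ⟨p', hp'⟩ : ∃ q, q = burst p (t + M) (i + 1) x := ⟨_, rfl⟩
    have hpv : IsPrice L U p' := hp' ▸ isPrice_burst hp _ _ hx
    have hag : ∀ s < t, p s = p' s := fun s hs => by rw [hp', burst_of_lt _ _ _ (by omega)]
    -- The interrupted burst agrees with the full one through step `t + M + i`, which determines the
    -- position at time `t + M + i + 1`.
    have ha : ∀ u ≤ i, a p₁ (t + M + u + 1) = a p' (t + M + u + 1) := by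
      intro u hu
      refine (H.causal _ _ _ hp₁v hpv fun s hs => ?_).1
      rw [hp₁, hp']
      rcases lt_or_ge s (t + M) with h | h
      · rw [burst_of_lt _ _ _ h, burst_of_lt _ _ _ h]
      · rw [burst_of_mem _ _ h (by omega), burst_of_mem _ _ h (by omega)]
    rw [ha i le_rfl, sum_congr rfl fun u hu => ha u (mem_range.1 hu).le] at hai
    have hS : 0 ≤ ∑ u ∈ range i, a p' (t + M + u + 1) := sum_nonneg fun _ _ => H.nonneg _ _ hpv
    have hN : occupancy (n p') (t + M + (i + 1)) - occupancy (n p) t =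
        ∑ u ∈ range M, n p' (t + u + 1) + ∑ u ∈ range (i + 1), n p' (t + M + u + 1) := by
      rw [H.occupancy_congr hp hpv hag]
      unfold occupancy
      simp only [sum_range_add]
      ring
    have hNU : 0 ≤ ∑ u ∈ range M, n p' (t + u + 1) :=
      sum_nonneg fun _ _ => (H.nonneg _ _ hpv).trans (H.le _ _ hpv)
    have hND : ∑ u ∈ range (i + 1), a p' (t + M + u + 1) ≤
        ∑ u ∈ range (i + 1), n p' (t + M + u + 1) := sum_le_sum fun _ _ => H.le _ _ hpv
    rw [sum_range_succ] at hND
    refine ⟨i + 1, hi, p', hp', _, ?_, Or.inr ⟨?_, rfl⟩⟩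
    · refine H.netLoss_burst hp hU hx hxU hrate p' hp' ?_
      -- At some step of the rest the occupied mass is at most its average, so the potential is low
      -- there and the climb to the last purchase is counted from that step.
      obtain ⟨v, hv, hnv⟩ := exists_mul_le_sum (fun u => n p' (t + u + 1)) hM
      have h1 := climb_mono (φ p') (show t ≤ t + v + 1 by omega)
      have h2 := sub_le_climb_sub (φ p') (show t + v + 1 ≤ t + M + (i + 1) by omega)
      have h3 := H.lower p' (t + M + (i + 1)) hpv
      have h4 := H.upper p' (t + v + 1) hpv
      rw [sum_range_succ, hN]
      rw [← add_assoc (t + M) i 1] at h2 h3 ⊢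
      -- The earlier purchases are at most `1 / M` of the last one, and the mass at time `t + v + 1`
      -- at most `1 / M` of the mass in the rest; together they stay below `1 / M` of the occupancy
      -- added.
      have h5 : ∑ u ∈ range i, a p' (t + M + u + 1) + n p' (t + v + 1) ≤
          (∑ u ∈ range M, n p' (t + u + 1) + ∑ u ∈ range (i + 1), n p' (t + M + u + 1)) / M := by
        rw [le_div_iff₀ hM']
        linarith
      have h6 := mul_le_mul_of_nonneg_left h5 hβ
      linarith
    · rw [hN]
      have := mul_nonneg hM'.le hS
      linarith

/-- Bursts at price `x` are repeated until one is completed. Each interruption adds `τ` to the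
occupancy, which never exceeds `C`, so `k` attempts are enough; the defects proportional to
occupancy telescope. -/
theorem IsReaction.exists_level (H : IsReaction L U β a n φ) (hβ : 0 ≤ β) {T M K : ℕ} {r C κ : ℝ}
    (hrob : ∀ p, IsPrice L U p → ∀ t ≤ T, (∀ s, t ≤ s → p s = U) → ∀ x ∈ Set.Icc L U,
      ∀ s₀, s₀ + K ≤ t → (∀ s, s₀ ≤ s → s < s₀ + K → p s ≤ x) →
      U - r * (x + κ) ≤ netGain U p (a p) (φ p) t)
    (hocc : ∀ p, IsPrice L U p → ∀ t ≤ T, occupancy (n p) t ≤ C)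
    (hM : 0 < M) {x τ : ℝ} (hτ : 0 < τ) (hx : x ∈ Set.Icc L U) (hxU : x < U - 2 * β)
    (hrate : 0 ≤ rate L U β x) (k : ℕ) (p : ℕ → ℝ) (hp : IsPrice L U p) (t : ℕ)
    (hU : ∀ s, t ≤ s → p s = U) (hT : t + k * (M + K) ≤ T)
    (hk : C < occupancy (n p) t + k * τ) :
    ∃ p' t', IsPrice L U p' ∧ (∀ s, t' ≤ s → p' s = U) ∧ t' ≤ t + k * (M + K) ∧
      U - r * (x + κ) ≤ netGain U p' (a p') (φ p') t' ∧
      netLoss L p (a p) (φ p) t +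
        rate L U β x * (netGain U p' (a p') (φ p') t' - netGain U p (a p) (φ p) t) -
        2 * (1 + rate L U β x) *
          (β * ((occupancy (n p') t' - occupancy (n p) t) / M + τ * (1 + M) ^ K)) ≤
        netLoss L p' (a p') (φ p') t' := by
  induction k generalizing p t with
  | zero =>
    have := hocc p hp t (by omega)
    push_cast at hk
    linarith
  | succ k ih =>
    obtain ⟨j, hj, p₁, hp₁, e, hloss, h⟩ :=
      H.exists_burst hβ hp (K := K) hM hU hτ.le hx hxU hrate
    have hpv : IsPrice L U p₁ := hp₁ ▸ isPrice_burst hp _ _ hx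
    have htail : ∀ s, t + M + j ≤ s → p₁ s = U := fun s hs => by
      rw [hp₁, burst_of_ge _ _ hs, hU _ (by omega)]
    have hag : ∀ s < t, p s = p₁ s := fun s hs => by rw [hp₁, burst_of_lt _ _ _ (by omega)]
    have hlen : t + (k + 1) * (M + K) = t + M + K + k * (M + K) := by ring
    have hM' : (0 : ℝ) < M := by exact_mod_cast hM
    have hε : 0 ≤ τ * (1 + (M : ℝ)) ^ K := by positivity
    rcases h with ⟨rfl, he⟩ | ⟨hτN, he⟩
    · refine ⟨p₁, t + M + j, hpv, htail, by omega, ?_, ?_⟩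
      · refine hrob p₁ hpv _ (by omega) htail x hx (t + M) le_rfl fun s h1 h2 => ?_
        rw [hp₁, burst_of_mem _ _ h1 h2]
      · have hN : 0 ≤ (occupancy (n p₁) (t + M + j) - occupancy (n p) t) / M := by
          refine div_nonneg (sub_nonneg.2 ?_) hM'.le
          rw [H.occupancy_congr hp hpv hag]
          exact sum_le_sum_of_subset_of_nonneg (range_mono (by omega))
            fun _ _ _ => (H.nonneg _ _ hpv).trans (H.le _ _ hpv)
        have h1 : e ≤ β * ((occupancy (n p₁) (t + M + j) - occupancy (n p) t) / M +
            τ * (1 + M) ^ j) := by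
          rw [he]
          exact mul_le_mul_of_nonneg_left (by linarith) hβ
        have h2 := mul_le_mul_of_nonneg_left h1 (show 0 ≤ 2 * (1 + rate L U β x) by linarith)
        linarith
    · obtain ⟨p', t', hp', htail', ht', hgain, hloss'⟩ :=
        ih p₁ hpv (t + M + j) htail (by omega) (by push_cast at hk; linarith)
      refine ⟨p', t', hp', htail', by omega, hgain, ?_⟩
      rw [he] at hloss
      have e1 : (occupancy (n p') t' - occupancy (n p) t) / (M : ℝ) =
          (occupancy (n p') t' - occupancy (n p₁) (t + M + j)) / M +
          (occupancy (n p₁) (t + M + j) - occupancy (n p) t) / M := by ring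
      rw [e1]
      linarith

/-! ### Summation over the falling price levels. -/

/-- A lower bound for the net loss that net gains of `U - r * y` at the prices `y ≥ x` entail,
less the part which is proportional to the net gain at price `x`. -/
noncomputable def lossBound (L U β r x : ℝ) : ℝ :=
  r * ((U - L) * Real.log ((U - 2 * β - x) / (U - 2 * β - U / r)) - (U / r - x)) -
    rate L U β x * (U - r * x)

theorem rate_mono {L U β x y : ℝ} (hUL : L ≤ U) (hx : x < U - 2 * β) (hyx : y ≤ x) :
    rate L U β y ≤ rate L U β x := by
  unfold rate
  have := div_le_div_of_nonneg_left (show 0 ≤ U - L by linarith)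
    (show 0 < U - 2 * β - x by linarith) (show U - 2 * β - x ≤ U - 2 * β - y by linarith)
  linarith

theorem rate_nonneg {L U β x : ℝ} (hβ : 0 ≤ β) (hx : x < U - 2 * β) (hL : L ≤ x) :
    0 ≤ rate L U β x := by
  unfold rate
  rw [sub_nonneg, one_le_div (by linarith)]
  linarith

/-- `lossBound` at `x` is the integral of `U - r y` against `d rate(y)` over `[x, U / r]`; this
compares a piece of it with a Riemann–Stieltjes term. -/
theorem lossBound_sub_le {L U β r x y : ℝ} (hUL : L ≤ U) (hr : 0 ≤ r)
    (hr' : U / r < U - 2 * β) (hx : x < U - 2 * β) (hyx : y ≤ x) :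
    lossBound L U β r y - lossBound L U β r x ≤
      (rate L U β x - rate L U β y) * (U - r * y) := by
  have hqx : 0 < U - 2 * β - x := by linarith
  have hqy : 0 < U - 2 * β - y := by linarith
  have hq0 : 0 < U - 2 * β - U / r := by linarith
  have h1 : Real.log (U - 2 * β - y) - Real.log (U - 2 * β - x) ≤ (x - y) / (U - 2 * β - x) := by
    rw [← Real.log_div hqy.ne' hqx.ne']
    have := Real.log_le_sub_one_of_pos (div_pos hqy hqx)
    have e : (U - 2 * β - y) / (U - 2 * β - x) - 1 = (x - y) / (U - 2 * β - x) := by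
      field_simp
      ring
    linarith
  have h2 := mul_le_mul_of_nonneg_left h1 (show 0 ≤ r * (U - L) from mul_nonneg hr (by linarith))
  have e : r * (U - L) * ((x - y) / (U - 2 * β - x)) = r * (x - y) * (rate L U β x + 1) := by
    unfold rate
    field_simp
    ring
  rw [e] at h2
  unfold lossBound
  rw [Real.log_div hqx.ne' hq0.ne', Real.log_div hqy.ne' hq0.ne']
  linarith

/-- Summation by parts: tracking loss minus `rate` times gain, each descent to a lower price
contributes the drop in `rate` times the current gain, for which robustness supplies a lower bound.
-/
theorem IsReaction.exists_levels (H : IsReaction L U β a n φ) (hβ : 0 ≤ β)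
    {T M K k : ℕ} {r C κ : ℝ}
    (hrob : ∀ p, IsPrice L U p → ∀ t ≤ T, (∀ s, t ≤ s → p s = U) → ∀ x ∈ Set.Icc L U,
      ∀ s₀, s₀ + K ≤ t → (∀ s, s₀ ≤ s → s < s₀ + K → p s ≤ x) →
      U - r * (x + κ) ≤ netGain U p (a p) (φ p) t)
    (hocc : ∀ p, IsPrice L U p → ∀ t ≤ T, occupancy (n p) t ≤ C)
    (hM : 0 < M) {τ δ : ℝ} (hτ : 0 < τ) (hδ : 0 ≤ δ) (hr : 0 < r)
    (hr' : U / r < U - 2 * β)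
    (hk : C < k * τ) (N : ℕ) (hN : U / r - N * δ = L) (hT : (N + 1) * (k * (M + K)) ≤ T) :
    ∀ i ≤ N, ∃ p t, IsPrice L U p ∧ (∀ s, t ≤ s → p s = U) ∧ t ≤ (i + 1) * (k * (M + K)) ∧
      U - r * (U / r - i * δ + κ) ≤ netGain U p (a p) (φ p) t ∧
      lossBound L U β r (U / r - i * δ) -
          r * (δ + κ) * (rate L U β (U / r) - rate L U β (U / r - i * δ)) -
          (i + 1) * (2 * (1 + rate L U β (U / r)) * (β * (C / M + τ * (1 + M) ^ K))) ≤
        netLoss L p (a p) (φ p) t -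
          rate L U β (U / r - i * δ) * netGain U p (a p) (φ p) t := by
  have hM' : (0 : ℝ) < M := by exact_mod_cast hM
  have hL0 : L ≤ U / r := by
    rw [← hN]
    have : 0 ≤ (N : ℝ) * δ := by positivity
    linarith
  have hUL : L ≤ U := by linarith
  have hxi : ∀ i ≤ N, L ≤ U / r - i * δ ∧ U / r - i * δ ≤ U / r := by
    intro i hi
    have h1 : (i : ℝ) * δ ≤ N * δ := mul_le_mul_of_nonneg_right (by exact_mod_cast hi) hδ
    have h2 : 0 ≤ (i : ℝ) * δ := by positivity
    constructor <;> linarith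
  have step : ∀ i ≤ N, ∀ p t, IsPrice L U p → (∀ s, t ≤ s → p s = U) →
      t ≤ i * (k * (M + K)) → ∃ p' t', IsPrice L U p' ∧ (∀ s, t' ≤ s → p' s = U) ∧
        t' ≤ (i + 1) * (k * (M + K)) ∧
        U - r * (U / r - i * δ + κ) ≤ netGain U p' (a p') (φ p') t' ∧
        netLoss L p (a p) (φ p) t + rate L U β (U / r - i * δ) *
            (netGain U p' (a p') (φ p') t' - netGain U p (a p) (φ p) t) -
          2 * (1 + rate L U β (U / r)) * (β * (C / M + τ * (1 + M) ^ K)) ≤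
        netLoss L p' (a p') (φ p') t' := by
    intro i hi p t hp hU ht
    obtain ⟨h1, h2⟩ := hxi i hi
    have hrate := rate_nonneg hβ (h2.trans_lt hr') h1
    have hocc0 := H.occupancy_nonneg hp t
    have hle : (i + 1) * (k * (M + K)) ≤ (N + 1) * (k * (M + K)) :=
      Nat.mul_le_mul_right _ (by omega)
    rw [add_one_mul] at hle
    obtain ⟨p', t', hp', hU', ht', hgain, hloss⟩ :=
      H.exists_level hβ hrob hocc hM hτ ⟨h1, by linarith⟩ (h2.trans_lt hr') hrate k p hp t hU
        (by omega) (by linarith)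
    refine ⟨p', t', hp', hU', by rw [add_one_mul]; omega, hgain, le_trans ?_ hloss⟩
    have e1 : (occupancy (n p') t' - occupancy (n p) t) / M ≤ C / M := by
      refine div_le_div_of_nonneg_right ?_ hM'.le
      have := hocc p' hp' t' (by omega)
      linarith
    have e2 : β * ((occupancy (n p') t' - occupancy (n p) t) / M + τ * (1 + M) ^ K) ≤
        β * (C / M + τ * (1 + M) ^ K) := mul_le_mul_of_nonneg_left (by linarith) hβ
    have e3 : 0 ≤ β * (C / M + τ * (1 + M) ^ K) := by
      have : 0 ≤ C := by
        have := hocc p hp t (by omega)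
        linarith
      positivity
    have e4 := rate_mono hUL hr' h2
    have e5 := mul_le_mul_of_nonneg_left e2 (show 0 ≤ 2 * (1 + rate L U β (U / r - i * δ)) by
      linarith)
    have e6 := mul_le_mul_of_nonneg_right
      (show 2 * (1 + rate L U β (U / r - i * δ)) ≤ 2 * (1 + rate L U β (U / r)) by linarith) e3
    linarith
  intro i
  induction i with
  | zero =>
    intro hi
    -- The start is the constant price `U` at time `0`, where gain, loss and climb vanish.
    obtain ⟨p', t', hp', hU', ht', hgain, hloss⟩ := step 0 hi (fun _ => U) 0
      (fun _ => ⟨hUL, le_rfl⟩) (fun _ _ => rfl) (by omega)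
    refine ⟨p', t', hp', hU', ht', hgain, ?_⟩
    have hq0 : U - 2 * β - U / r ≠ 0 := by linarith
    have e0 : lossBound L U β r (U / r) = 0 := by
      unfold lossBound
      rw [div_self hq0, Real.log_one, mul_div_cancel₀ _ hr.ne']
      ring
    simp only [netLoss, netGain, climb, range_zero, sum_empty] at hloss ⊢
    simp only [CharP.cast_eq_zero, zero_mul, sub_zero, zero_add, mul_zero, e0, sub_self] at hloss ⊢
    linarith
  | succ i ih =>
    intro hi
    obtain ⟨p, t, hp, hU, ht, hgain, hloss⟩ := ih (by omega)
    obtain ⟨p', t', hp', hU', ht', hgain', hloss'⟩ := step (i + 1) hi p t hp hU ht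
    refine ⟨p', t', hp', hU', ht', hgain', ?_⟩
    have hx := hxi i (by omega)
    have ey : U / r - ((i + 1 : ℕ) : ℝ) * δ = U / r - i * δ - δ := by push_cast; ring
    rw [ey] at hloss' hgain' ⊢
    have h1 := lossBound_sub_le hUL hr.le hr' (hx.2.trans_lt hr')
      (show U / r - i * δ - δ ≤ U / r - i * δ by linarith)
    have h2 := rate_mono hUL (hx.2.trans_lt hr')
      (show U / r - i * δ - δ ≤ U / r - i * δ by linarith)
    -- The gain is bounded at the upper level while `h1` uses the lower one; the difference `r * δ`
    -- goes into the error term.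
    have h3 := mul_le_mul_of_nonneg_left hgain (sub_nonneg.2 h2)
    push_cast
    generalize netGain U p (a p) (φ p) t = B at *
    generalize netGain U p' (a p') (φ p') t' = B' at *
    generalize rate L U β (U / r - i * δ - δ) = h' at *
    generalize rate L U β (U / r - i * δ) = h at *
    linarith

end Reaction

/-- Rests have length `N ^ 2`, full bursts length `N`, and there are `N + 1` levels. An error of
order `1 / N ^ 2` per level then sums to order `1 / N`. -/
theorem IsReaction.excess_le {L U β : ℝ} {a n φ : (ℕ → ℝ) → ℕ → ℝ}
    (H : IsReaction L U β a n φ) (hβ : 0 ≤ β) {N k : ℕ} (hN : 0 < N)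
    {r b C : ℝ} (hr : 0 < r) (hr' : U / r < U - 2 * β) (hLr : L ≤ U / r) (hC : 0 ≤ C)
    {T₀ : ℕ} (hk : C < k * (1 / ((N ^ 2 : ℕ) * (1 + ((N ^ 2 : ℕ) : ℝ)) ^ N)))
    (hT : (N + 1) * (k * (N ^ 2 + N)) ≤ T₀)
    (hrob : ∀ p, IsPrice L U p → ∀ t ≤ T₀, (∀ s, t ≤ s → p s = U) → ∀ x ∈ Set.Icc L U,
      ∀ s₀, s₀ + N ≤ t → (∀ s, s₀ ≤ s → s < s₀ + N → p s ≤ x) →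
      U - r * (x + 2 * β / N) ≤ netGain U p (a p) (φ p) t)
    (hocc : ∀ p, IsPrice L U p → ∀ t ≤ T₀, occupancy (n p) t ≤ C)
    (hcons : ∀ p, IsPrice L U p → (∀ s, T₀ ≤ s → s < T₀ + N → p s ≤ L) → ∀ t ≤ T₀,
      L + netLoss L p (a p) (φ p) t ≤ b * (L + 2 * β / N)) :
    excess L U β r ≤ (b - 1) * L + (r * (U / r - L + 2 * β) * rate L U β (U / r) +
      4 * (1 + rate L U β (U / r)) * (β * (C + 1)) + b * (2 * β)) / N := by
  have hN' : (0 : ℝ) < N := by exact_mod_cast hN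
  have hN1 : (1 : ℝ) ≤ N := by exact_mod_cast hN
  have hM : 0 < N ^ 2 := by positivity
  have hM' : (0 : ℝ) < (N ^ 2 : ℕ) := by exact_mod_cast hM
  have hUL : L ≤ U := by linarith
  have hδ : 0 ≤ (U / r - L) / N := div_nonneg (by linarith) hN'.le
  have hend : U / r - N * ((U / r - L) / N) = L := by field_simp; ring
  obtain ⟨p, t, hp, hU, ht, hgain, hloss⟩ :=
    H.exists_levels hβ hrob hocc hM (by positivity) hδ hr hr' hk N hend hT N le_rfl
  rw [hend] at hgain hloss
  have ht' : t ≤ T₀ := ht.trans hT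
  have hpv := isPrice_burst hp T₀ N (x := L) ⟨le_rfl, hUL⟩
  have hc := hcons _ hpv (fun s h1 h2 => by rw [burst_of_mem _ _ h1 h2]) t ht'
  rw [H.netLoss_congr hpv hp fun s hs => burst_of_lt _ _ _ (hs.trans_le ht')] at hc
  have hrate := rate_nonneg hβ (hLr.trans_lt hr') le_rfl
  have hrate0 := rate_mono hUL hr' hLr
  -- Robustness at the last level `L` restores the term subtracted in `lossBound`.
  have hg := mul_le_mul_of_nonneg_left hgain hrate
  -- The threshold `τ` in `hk` is chosen so that a completed burst contributes exactly `1 / N ^ 2`.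
  have e1 : C / (N ^ 2 : ℕ) + 1 / ((N ^ 2 : ℕ) * (1 + ((N ^ 2 : ℕ) : ℝ)) ^ N) *
      (1 + ((N ^ 2 : ℕ) : ℝ)) ^ N = (C + 1) / (N ^ 2 : ℕ) := by
    field_simp
  have e2 : ((N : ℝ) + 1) * ((C + 1) / (N ^ 2 : ℕ)) ≤ 2 * ((C + 1) / N) := by
    have : ((N : ℝ) + 1) * ((C + 1) / (N ^ 2 : ℕ)) = (N + 1) / N * ((C + 1) / N) := by
      push_cast
      field_simp
    rw [this]
    refine mul_le_mul_of_nonneg_right ?_ (by positivity)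
    rw [div_le_iff₀ hN']
    linarith
  rw [e1] at hloss
  have e3 := mul_le_mul_of_nonneg_left e2
    (show 0 ≤ 2 * (1 + rate L U β (U / r)) * β from mul_nonneg (by linarith) hβ)
  have e4 : excess L U β r = lossBound L U β r L + rate L U β L * (U - r * L) := by
    unfold excess lossBound
    have h1 : U - L - 2 * β = U - 2 * β - L := by ring
    have h2 : U - U / r - 2 * β = U - 2 * β - U / r := by ring
    have h3 : r * (U / r) = U := mul_div_cancel₀ _ hr.ne'
    rw [h1, h2]
    linear_combination h3
  have e5 : (r * (U / r - L + 2 * β) * rate L U β (U / r) +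
      4 * (1 + rate L U β (U / r)) * (β * (C + 1)) + b * (2 * β)) / N =
      r * ((U / r - L) / N + 2 * β / N) * rate L U β (U / r) +
      2 * (1 + rate L U β (U / r)) * β * (2 * ((C + 1) / N)) + b * (2 * β / N) := by
    field_simp
    ring
  have e6 : 0 ≤ r * ((U / r - L) / N) * rate L U β L := by positivity
  rw [e4, e5]
  generalize (U / r - L) / (N : ℝ) = δ at *
  generalize 2 * β / (N : ℝ) = κ at *
  generalize (C + 1) / ((N ^ 2 : ℕ) : ℝ) = c at *
  generalize (C + 1) / (N : ℝ) = c' at *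
  linarith

/-! ### Bounds for the transport cost. -/

section Transport

variable {X : Type*} [Fintype X]

theorem switchCost_le {d : X → X → ℝ} (hd : ∀ a b, 0 ≤ d a b) {x y : X → ℝ} (π : X → X → ℝ)
    (hπ : ∀ a b, 0 ≤ π a b) (hx : ∀ a, ∑ b, π a b = x a) (hy : ∀ b, ∑ a, π a b = y b) :
    switchCost d x y ≤ ∑ a, ∑ b, π a b * d a b := by
  refine csInf_le ⟨0, ?_⟩ ⟨π, hπ, hx, hy, rfl⟩
  rintro s ⟨ρ, hρ, -, -, rfl⟩
  exact sum_nonneg fun a _ => sum_nonneg fun b _ => mul_nonneg (hρ a b) (hd a b)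

theorem switchCost_le_prod {d : X → X → ℝ} (hd : ∀ a b, 0 ≤ d a b) {x y : X → ℝ}
    (hx : IsAllocation x) (hy : IsAllocation y) :
    switchCost d x y ≤ ∑ a, ∑ b, x a * y b * d a b :=
  switchCost_le hd (fun a b => x a * y b) (fun a b => mul_nonneg (hx.1 a) (hy.1 b))
    (fun a => by rw [← mul_sum, hy.2, mul_one]) (fun b => by rw [← sum_mul, hx.2, one_mul])

theorem switchCost_self_le [DecidableEq X] {d : X → X → ℝ} (hd : ∀ a b, 0 ≤ d a b)
    (hd0 : ∀ a, d a a = 0) {x : X → ℝ} (hx : IsAllocation x) : switchCost d x x ≤ 0 := by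
  refine (switchCost_le hd (fun a b => if a = b then x a else 0) (fun a b => ?_) (fun a => ?_)
    fun b => ?_).trans_eq ?_
  · split_ifs
    exacts [hx.1 a, le_rfl]
  · simp
  · simp
  · simp [hd0]

/-- Weak Kantorovich duality. -/
theorem abs_sub_le_switchCost {d : X → X → ℝ} {ψ : X → ℝ} (hψ : ∀ a b, |ψ b - ψ a| ≤ d a b)
    {x y : X → ℝ} (hx : IsAllocation x) (hy : IsAllocation y) :
    |∑ a, ψ a * y a - ∑ a, ψ a * x a| ≤ switchCost d x y := by
  refine le_csInf ⟨_, fun a b => x a * y b, fun a b => mul_nonneg (hx.1 a) (hy.1 b),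
    fun a => by rw [← mul_sum, hy.2, mul_one], fun b => by rw [← sum_mul, hx.2, one_mul], rfl⟩ ?_
  rintro s ⟨π, hπ, hπx, hπy, rfl⟩
  have e : ∑ a, ψ a * y a - ∑ a, ψ a * x a = ∑ a, ∑ b, π a b * (ψ b - ψ a) := by
    simp only [← hπx, ← hπy, mul_sum, mul_sub, sum_sub_distrib]
    rw [sum_comm]
    simp only [mul_comm]
  rw [e]
  refine (abs_sum_le_sum_abs _ _).trans (sum_le_sum fun a _ => ?_)
  refine (abs_sum_le_sum_abs _ _).trans (sum_le_sum fun b _ => ?_)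
  rw [abs_mul, abs_of_nonneg (hπ a b)]
  exact mul_le_mul_of_nonneg_left (hψ a b) (hπ a b)

end Transport

/-! ### The adversarial instances and their block solutions. -/

section Instances

variable {X : Type*} [DecidableEq X] (off pt : X)

/-- The mass `θ` at `pt`, the remaining mass at `off`. -/
noncomputable def mix (θ : ℝ) (a : X) : ℝ := (if a = off then 1 - θ else 0) + if a = pt then θ else 0

theorem sum_mul_mix [Fintype X] (g : X → ℝ) (θ : ℝ) :
    ∑ a, g a * mix off pt θ a = (1 - θ) * g off + θ * g pt := by
  simp [mix, mul_add, sum_add_distrib, mul_comm]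

theorem isAllocation_mix [Fintype X] {θ : ℝ} (h0 : 0 ≤ θ) (h1 : θ ≤ 1) :
    IsAllocation (mix off pt θ) := by
  refine ⟨fun a => ?_, ?_⟩
  · unfold mix
    split_ifs <;> linarith
  · have := sum_mul_mix off pt (fun _ => 1) θ
    simpa using this

theorem mix_zero : mix off pt 0 = Pi.single off 1 := by
  ext a
  simp [mix, Pi.single_apply]

/-- The instance with slope `p t` at `pt`, slope `U` at all other points except `off`, and a
long-term constraint on the mass at `pt`. -/
noncomputable def priceInstance (U : ℝ) (T : ℕ) (p : ℕ → ℝ) : Instance X where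
  T := T
  c a := if a = pt then 1 else 0
  f t a y := (if a = off then 0 else if a = pt then p t else U) * y

/-- Mass `1 / K` at `pt` during the `K` steps from time `s₀` on. -/
noncomputable def block (T s₀ K : ℕ) (t : Fin T) : X → ℝ :=
  mix off pt (if s₀ ≤ t ∧ (t : ℕ) < s₀ + K then 1 / K else 0)

theorem sum_block_weight {T s₀ K : ℕ} (hK : 0 < K) (hT : s₀ + K ≤ T) :
    ∑ t : Fin T, (if s₀ ≤ (t : ℕ) ∧ (t : ℕ) < s₀ + K then 1 / (K : ℝ) else 0) = 1 := by
  rw [Fin.sum_univ_eq_sum_range (fun t => if s₀ ≤ t ∧ t < s₀ + K then 1 / (K : ℝ) else 0) T,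
    ← sum_filter]
  have : (range T).filter (fun t => s₀ ≤ t ∧ t < s₀ + K) = Ico s₀ (s₀ + K) := by
    ext t
    simp only [mem_filter, mem_range, mem_Ico]
    omega
  rw [this]
  have hK' : (K : ℝ) ≠ 0 := by exact_mod_cast hK.ne'
  simp [hK']

theorem block_weight_mem (K : ℕ) (q : Prop) [Decidable q] :
    0 ≤ (if q then 1 / (K : ℝ) else 0) ∧ (if q then 1 / (K : ℝ) else 0) ≤ 1 := by
  split_ifs
  · exact ⟨by positivity, by simpa using Nat.cast_inv_le_one K⟩
  · simp

variable {off pt}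

theorem feasible_block [Fintype X] (hne : pt ≠ off) (U : ℝ) (p : ℕ → ℝ) {T s₀ K : ℕ} (hK : 0 < K)
    (hT : s₀ + K ≤ T) : Feasible (priceInstance off pt U T p) (block off pt T s₀ K) := by
  refine ⟨fun t => isAllocation_mix _ _ (block_weight_mem K _).1 (block_weight_mem K _).2, ?_⟩
  refine (sum_block_weight hK hT).symm.le.trans_eq (sum_congr rfl fun t _ => ?_)
  simp only [priceInstance, block]
  rw [sum_mul_mix]
  simp [hne.symm]

theorem isValid_priceInstance [Fintype X] (hne : pt ≠ off) {L U : ℝ} (hUL : L ≤ U) {p : ℕ → ℝ}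
    (hp : IsPrice L U p) {T K : ℕ} (hK : 0 < K) (hT : K ≤ T) :
    IsValid off L U (priceInstance off pt U T p) where
  c_mem a := by
    simp only [priceInstance]
    split_ifs <;> simp
  c_off := by simp [priceInstance, hne.symm]
  f_off t x _ := by simp [priceInstance]
  f_convex t a := (LinearMap.mulLeft ℝ _).convexOn (convex_Icc 0 1)
  f_zero t a := by simp [priceInstance]
  f_slope t a ha x _ := by
    refine ⟨if a = pt then p t else U, ?_, ?_⟩
    · split_ifs
      exacts [hp t, ⟨hUL, le_rfl⟩]
    · simp only [priceInstance, if_neg ha]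
      simpa using ((hasDerivAt_id x).const_mul (if a = pt then p t else U)).hasDerivWithinAt
  feasible := ⟨_, feasible_block hne U p (s₀ := 0) hK (by omega)⟩

theorem trajectory_block (T s₀ K : ℕ) (hT : s₀ + K ≤ T) (s : ℕ) :
    trajectory off (block off pt T s₀ K) s =
      mix off pt (if s₀ + 1 ≤ s ∧ s < s₀ + 1 + K then 1 / K else 0) := by
  cases s with
  | zero => simp [trajectory, mix_zero]
  | succ s =>
    simp only [trajectory]
    by_cases h : s < T
    · have : (s₀ + 1 ≤ s + 1 ∧ s + 1 < s₀ + 1 + K) ↔ (s₀ ≤ s ∧ s < s₀ + K) := by omega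
      simp only [dif_pos h, block, this]
    · simp only [dif_neg h]
      rw [if_neg (by omega), mix_zero]

theorem starDist_nonneg {w : X → ℝ} (hw : ∀ a, 0 ≤ w a) (a b : X) :
    0 ≤ starDist w a b := by
  unfold starDist
  split_ifs
  exacts [le_rfl, add_nonneg (hw a) (hw b)]

theorem starDist_self (w : X → ℝ) (a : X) : starDist w a a = 0 := if_pos rfl

theorem starDist_comm (w : X → ℝ) (a b : X) : starDist w a b = starDist w b a := by
  simp only [starDist, eq_comm, add_comm]

theorem switchCost_mix_le [Fintype X] {w : X → ℝ} (hw : ∀ a, 0 ≤ w a) {θ : ℝ} (h0 : 0 ≤ θ)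
    (h1 : θ ≤ 1) :
    switchCost (starDist w) (mix off pt 0) (mix off pt θ) ≤ starDist w off pt * θ ∧
    switchCost (starDist w) (mix off pt θ) (mix off pt 0) ≤ starDist w off pt * θ := by
  have hθ := isAllocation_mix off pt h0 h1
  have hz := isAllocation_mix off pt le_rfl zero_le_one
  constructor
  · refine (switchCost_le_prod (starDist_nonneg hw) hz hθ).trans_eq ?_
    simp only [mix_zero]
    simp only [Pi.single_apply, ite_mul, one_mul, zero_mul, sum_ite_eq', mem_univ, if_true,
      sum_ite_irrel, sum_const_zero]
    simp only [mul_comm (mix off pt θ _), sum_mul_mix, starDist_self]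
    ring
  · refine (switchCost_le_prod (starDist_nonneg hw) hθ hz).trans_eq ?_
    simp only [mix_zero]
    simp only [Pi.single_apply, mul_ite, ite_mul, mul_one, mul_zero, zero_mul, sum_ite_eq',
      mem_univ, if_true]
    simp only [mul_comm (mix off pt θ _), sum_mul_mix, starDist_self, starDist_comm w pt off]
    ring

/-- Spreading the purchase over `K` steps means that only mass `1 / K` travels, once in each
direction. -/
theorem cost_block_le [Fintype X] {w : X → ℝ} (hw : ∀ a, 0 ≤ w a) (hne : pt ≠ off) (U : ℝ)
    {p : ℕ → ℝ} {T s₀ K : ℕ} (hK : 0 < K) (hT : s₀ + K ≤ T) {x : ℝ}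
    (hp : ∀ s, s₀ ≤ s → s < s₀ + K → p s ≤ x) :
    cost w off (priceInstance off pt U T p) (block off pt T s₀ K) ≤
      x + 2 * starDist w off pt / K := by
  have hK' : (0 : ℝ) < K := by exact_mod_cast hK
  have hd := starDist_nonneg hw off pt
  refine add_le_add ?_ ?_
  · calc _ ≤ ∑ t : Fin T, x * (if s₀ ≤ (t : ℕ) ∧ (t : ℕ) < s₀ + K then 1 / (K : ℝ) else 0) := by
          refine sum_le_sum fun t _ => ?_
          simp only [priceInstance, block]
          rw [sum_mul_mix]
          simp only [if_true, if_neg hne, mul_zero, zero_add]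
          split_ifs with h
          · rw [mul_comm]
            exact mul_le_mul_of_nonneg_right (hp t h.1 h.2) (by positivity)
          · simp
      _ = x := by rw [← mul_sum, sum_block_weight hK hT, mul_one]
  · have key : ∀ s, switchCost (starDist w) (trajectory off (block off pt T s₀ K) s)
        (trajectory off (block off pt T s₀ K) (s + 1)) ≤
        (if s = s₀ then starDist w off pt * (1 / K) else 0) +
          if s = s₀ + K then starDist w off pt * (1 / K) else 0 := by
      intro s
      rw [trajectory_block T s₀ K hT, trajectory_block T s₀ K hT]
      have hb := block_weight_mem K True
      rw [if_pos trivial] at hb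
      have h1 := switchCost_mix_le (off := off) (pt := pt) hw hb.1 hb.2
      have h2 := fun q : Prop => fun _ : Decidable q => switchCost_self_le (starDist_nonneg hw)
        (starDist_self w) (isAllocation_mix off pt (block_weight_mem K q).1 (block_weight_mem K q).2)
      rcases eq_or_ne s s₀ with hs | hs
      · rw [if_neg (by omega), if_pos (by omega), if_pos hs, if_neg (by omega), add_zero]
        exact h1.1
      rcases eq_or_ne s (s₀ + K) with hs' | hs'
      · rw [if_pos (by omega), if_neg (by omega), if_neg hs, if_pos hs', zero_add]
        exact h1.2
      · rw [if_neg hs, if_neg hs', add_zero]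
        have : (s₀ + 1 ≤ s + 1 ∧ s + 1 < s₀ + 1 + K) ↔ (s₀ + 1 ≤ s ∧ s < s₀ + 1 + K) := by omega
        simp only [this]
        exact h2 _ _
    refine (sum_le_sum fun s _ => key s).trans_eq ?_
    rw [sum_add_distrib, sum_ite_eq', sum_ite_eq', if_pos, if_pos]
    · ring
    · simp only [priceInstance, mem_range]; omega
    · simp only [priceInstance, mem_range]; omega

end Instances

/-! ### The potential measuring the distance from OFF. -/

section Potential

variable {X : Type*} [DecidableEq X] {off pt : X} {w : X → ℝ}

/-- A potential on the points, `1`-Lipschitz for the star metric. -/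
noncomputable def starPotential (w : X → ℝ) (off pt a : X) : ℝ :=
  if a = off then 0 else if a = pt then starDist w off pt else w off

theorem abs_starPotential_sub_le (hw : ∀ a, 0 ≤ w a) (hne : pt ≠ off) (a b : X) :
    |starPotential w off pt b - starPotential w off pt a| ≤ starDist w a b := by
  have h1 := hw off
  have h2 := hw a
  have h3 := hw b
  unfold starPotential starDist
  rw [if_neg hne.symm]
  rw [abs_le]
  by_cases hab : a = b
  · subst hab; simp
  · rw [if_neg hab]
    split_ifs <;> first | (constructor <;> linarith) | (subst_vars; constructor <;> linarith)

end Potential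

/-! ### Lower bounds for the cost of a feasible solution. -/

section Cost

variable {X : Type*} [Fintype X] [DecidableEq X] {off pt : X} {w : X → ℝ} {L U : ℝ}

theorem isAllocation_trajectory {T : ℕ} {x : Fin T → X → ℝ} (hx : ∀ t, IsAllocation (x t)) (s : ℕ) :
    IsAllocation (trajectory off x s) := by
  have h0 : IsAllocation (Pi.single off 1 : X → ℝ) := by
    rw [← mix_zero off off]
    exact isAllocation_mix _ _ le_rfl zero_le_one
  cases s with
  | zero => exact h0
  | succ s =>
    simp only [trajectory]
    split_ifs
    exacts [hx _, h0]

theorem two_mul_climb_eq (φ : ℕ → ℝ) (T : ℕ) (h : φ T = φ 0) :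
    2 * climb φ T = ∑ s ∈ range T, |φ (s + 1) - φ s| := by
  have h1 : ∑ s ∈ range T, (φ (s + 1) - φ s) = 0 := by rw [sum_range_sub, h, sub_self]
  rw [← sub_zero (2 * climb φ T)]
  nth_rw 1 [← h1]
  rw [climb, mul_sum, ← sum_sub_distrib]
  refine sum_congr rfl fun s _ => ?_
  rcases max_cases (φ (s + 1) - φ s) 0 with h | h
  · rw [h.1, abs_of_nonneg h.2]; ring
  · rw [h.1, abs_of_neg h.2]; ring

/-- The trajectory starts and ends at OFF, so the total variation of the potential is twice its
climb, and by duality it bounds the switching cost from below. -/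
theorem le_cost_priceInstance (hw : ∀ a, 0 ≤ w a) (hne : pt ≠ off) {T : ℕ} {p g : ℕ → ℝ}
    {x : Fin T → X → ℝ} (hx : Feasible (priceInstance off pt U T p) x)
    (hg : ∀ s < T, g s ≤
      ∑ a, (if a = off then 0 else if a = pt then p s else U) * trajectory off x (s + 1) a) :
    ∑ s ∈ range T, g s +
        2 * climb (fun s => ∑ a, starPotential w off pt a * trajectory off x s a) T ≤
      cost w off (priceInstance off pt U T p) x := by
  refine add_le_add ?_ ?_
  · rw [← Fin.sum_univ_eq_sum_range]
    refine sum_le_sum fun t _ => (hg t t.2).trans_eq ?_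
    simp [trajectory, priceInstance]
  · have h1 := climb_mono (fun s => ∑ a, starPotential w off pt a * trajectory off x s a)
      (Nat.le_succ T)
    refine (mul_le_mul_of_nonneg_left h1 zero_le_two).trans ?_
    rw [two_mul_climb_eq _ _ (by simp [trajectory])]
    exact sum_le_sum fun s _ => abs_sub_le_switchCost (abs_starPotential_sub_le hw hne)
      (isAllocation_trajectory hx.1 s) (isAllocation_trajectory hx.1 (s + 1))

/-- The purchases at `pt` total at least one unit, so the hitting cost can be compared with buying
that unit at `U` or at `L`. Every point besides OFF has slope at least `L`, which gives the bound on
occupancy. -/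
theorem cost_priceInstance_bounds (hw : ∀ a, 0 ≤ w a) (hne : pt ≠ off) (hL : 0 < L) (hUL : L ≤ U)
    {T : ℕ} {p : ℕ → ℝ} (hp : IsPrice L U p) {x : Fin T → X → ℝ}
    (hx : Feasible (priceInstance off pt U T p) x) (a n φ : ℕ → ℝ)
    (ha : a = fun s => trajectory off x s pt) (hn : n = fun s => 1 - trajectory off x s off)
    (hφ : φ = fun s => ∑ a, starPotential w off pt a * trajectory off x s a) :
    U - netGain U p a φ T ≤ cost w off (priceInstance off pt U T p) x ∧
    L + netLoss L p a φ T ≤ cost w off (priceInstance off pt U T p) x ∧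
    L * occupancy n T ≤ cost w off (priceInstance off pt U T p) x := by
  have hall : ∀ t : Fin T, IsAllocation (x t) := hx.1
  have hy := isAllocation_trajectory (off := off) hall
  have hslope : ∀ s b, b ≠ off → L ≤ if b = off then 0 else if b = pt then p s else U := by
    intro s b hb
    rw [if_neg hb]
    split_ifs
    exacts [(hp s).1, hUL]
  have hnn : ∀ s b, 0 ≤ (if b = off then 0 else if b = pt then p s else U) *
      trajectory off x (s + 1) b := by
    intro s b
    by_cases hb : b = off
    · simp [hb]
    · exact mul_nonneg (hL.le.trans (hslope s b hb)) ((hy _).1 b)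
  have h1 := le_cost_priceInstance (g := fun s => p s * a (s + 1)) hw hne hx fun s hs => by
    rw [ha]
    refine le_trans (le_of_eq ?_) (single_le_sum (fun b _ => hnn s b) (mem_univ pt))
    simp [hne]
  have h2 := le_cost_priceInstance (g := fun s => L * n (s + 1)) hw hne hx fun s hs => by
    have : n (s + 1) = ∑ b ∈ univ.erase off, trajectory off x (s + 1) b := by
      rw [sum_erase_eq_sub (mem_univ _), (hy (s + 1)).2, hn]
    rw [this, mul_sum, ← sum_erase univ (a := off)]
    · exact sum_le_sum fun b hb => mul_le_mul_of_nonneg_right (hslope s b (ne_of_mem_erase hb))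
        ((hy _).1 b)
    · simp
  have hc : 1 ≤ ∑ s ∈ range T, a (s + 1) := by
    rw [← Fin.sum_univ_eq_sum_range (fun s => a (s + 1)), ha]
    refine hx.2.trans_eq (sum_congr rfl fun t _ => ?_)
    have ht : (t : ℕ) < T := t.2
    simp only [priceInstance, trajectory, ht, dif_pos, ite_mul, one_mul, zero_mul, sum_ite_eq',
      mem_univ, if_true]
    rfl
  rw [← hφ] at h1 h2
  have h0 : 0 ≤ climb φ T := sum_nonneg fun _ _ => le_max_right _ _
  have e1 : ∑ s ∈ range T, (U - p s) * a (s + 1) =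
      U * ∑ s ∈ range T, a (s + 1) - ∑ s ∈ range T, p s * a (s + 1) := by
    simp only [sub_mul, sum_sub_distrib, mul_sum]
  have e2 : ∑ s ∈ range T, (p s - L) * a (s + 1) =
      ∑ s ∈ range T, p s * a (s + 1) - L * ∑ s ∈ range T, a (s + 1) := by
    simp only [sub_mul, sum_sub_distrib, mul_sum]
  have k1 := mul_le_mul_of_nonneg_left hc (hL.le.trans hUL)
  have k2 := mul_le_mul_of_nonneg_left hc hL.le
  unfold netGain netLoss occupancy
  rw [e1, e2]
  rw [← mul_sum] at h2
  refine ⟨?_, ?_, ?_⟩ <;> linarith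

end Cost

/-! ### From online algorithms to reactions. -/

section Algorithm

variable {X : Type*} [Fintype X] [DecidableEq X] {off pt : X} {w : X → ℝ} {L U : ℝ}

theorem netGain_anti {p a φ : ℕ → ℝ} {t T : ℕ} (h : t ≤ T) (hU : ∀ s, t ≤ s → p s = U) :
    netGain U p a φ T ≤ netGain U p a φ t := by
  obtain ⟨k, rfl⟩ := Nat.exists_eq_add_of_le h
  unfold netGain
  have h1 := climb_mono φ h
  have h2 : ∑ u ∈ range k, (U - p (t + u)) * a (t + u + 1) = 0 :=
    sum_eq_zero fun u _ => by rw [hU _ (by omega)]; ring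
  rw [sum_range_add, h2]
  linarith

theorem netLoss_mono {p a φ : ℕ → ℝ} {t T : ℕ} (h : t ≤ T) (hp : IsPrice L U p)
    (ha : ∀ s, 0 ≤ a s) : netLoss L p a φ t ≤ netLoss L p a φ T := by
  have h1 := climb_mono φ h
  have h2 : ∑ s ∈ range t, (p s - L) * a (s + 1) ≤ ∑ s ∈ range T, (p s - L) * a (s + 1) :=
    sum_le_sum_of_subset_of_nonneg (range_mono h) fun _ _ _ =>
      mul_nonneg (sub_nonneg.2 (hp _).1) (ha _)
  unfold netLoss
  linarith

theorem starPotential_bounds (hw : ∀ a, 0 ≤ w a) (hne : pt ≠ off) {x : X → ℝ}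
    (hx : IsAllocation x) :
    starDist w off pt * x pt ≤ ∑ a, starPotential w off pt a * x a ∧
      ∑ a, starPotential w off pt a * x a ≤ starDist w off pt * (1 - x off) := by
  have h0 : 0 ≤ starDist w off pt := starDist_nonneg hw _ _
  have h1 : w off ≤ starDist w off pt := by
    rw [starDist, if_neg hne.symm]
    linarith [hw pt]
  constructor
  · have hs : starPotential w off pt pt = starDist w off pt := by simp [starPotential, hne]
    rw [← hs]
    refine single_le_sum (f := fun a => starPotential w off pt a * x a)
      (fun b _ => mul_nonneg ?_ (hx.1 b)) (mem_univ pt)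
    unfold starPotential
    split_ifs
    exacts [le_rfl, h0, hw off]
  · rw [← hx.2, ← sum_erase_eq_sub (mem_univ off), mul_sum, ← sum_erase univ (a := off)]
    · refine sum_le_sum fun b hb => mul_le_mul_of_nonneg_right ?_ (hx.1 b)
      rw [starPotential, if_neg (ne_of_mem_erase hb)]
      split_ifs
      exacts [le_rfl, h1]
    · simp [starPotential]

/-- Horizon, constraint and advice are the same for all price sequences, so the algorithm
distinguishes them only by the prices revealed. -/
theorem isReaction_trajectory (hw : ∀ a, 0 ≤ w a) (hne : pt ≠ off) (hUL : L ≤ U) {A : Strategy X}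
    (hA : IsOnlineAlgorithm off L U A) {T K : ℕ} (hK : 0 < K) (hT : K ≤ T) (adv : Fin T → X → ℝ)
    (hadv : ∀ p, Feasible (priceInstance off pt U T p) adv) (x : (ℕ → ℝ) → Fin T → X → ℝ)
    (hx : ∀ p, x p = A (priceInstance off pt U T p) adv) :
    IsReaction L U (starDist w off pt) (fun p s => trajectory off (x p) s pt)
      (fun p s => 1 - trajectory off (x p) s off)
      fun p s => ∑ a, starPotential w off pt a * trajectory off (x p) s a := by
  have hval : ∀ p, IsPrice L U p → IsValid off L U (priceInstance off pt U T p) :=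
    fun p hp => isValid_priceInstance hne hUL hp hK hT
  have hall : ∀ p s, IsPrice L U p → IsAllocation (trajectory off (x p) s) := fun p s hp =>
    isAllocation_trajectory
      (fun t => by rw [hx]; exact (hA.feasible _ (hval p hp) adv (hadv p)).1 t) s
  refine ⟨fun p s hp => (hall p s hp).1 pt, fun p s hp => ?_,
    fun p s hp => (starPotential_bounds hw hne (hall p s hp)).1,
    fun p s hp => (starPotential_bounds hw hne (hall p s hp)).2, fun p p' s hp hp' h => ?_⟩
  · have h1 := sum_le_sum_of_subset_of_nonneg (subset_univ {off, pt})
      fun b _ _ => (hall p s hp).1 b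
    rw [(hall p s hp).2, sum_pair hne.symm] at h1
    linarith
  · have : trajectory off (x p) s = trajectory off (x p') s := by
      cases s with
      | zero => rfl
      | succ s =>
        simp only [trajectory]
        split_ifs with hs
        · rw [hx, hx]
          refine hA.causal T _ _ _ (hval p hp) (hval p' hp') adv (hadv p) ⟨s, hs⟩ fun u hu => ?_
          have : p u = p' u := h u (Nat.lt_succ_of_le hu)
          funext a x
          rw [this]
        · rfl
    simp only [this, and_self]

theorem excess_le_of_isRobust (hw : ∀ a, 0 ≤ w a) (hne : pt ≠ off) (hL : 0 < L)
    (hUL : 2 * starDist w off pt < U - L) {A : Strategy X} (hA : IsOnlineAlgorithm off L U A)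
    {ε r₀ r : ℝ} (hε : 0 ≤ ε) (hcons : IsConsistent w off L U A (1 + ε))
    (hrob : IsRobust w off L U A r₀) (hr₀ : r₀ ≤ r)
    (hr : r ∈ Set.Ioc (U / (U - 2 * starDist w off pt)) (U / L)) :
    excess L U (starDist w off pt) r ≤ ε * L := by
  have hβ : 0 ≤ starDist w off pt := starDist_nonneg hw _ _
  have hS : 0 < U - 2 * starDist w off pt := by linarith
  have hU : 0 < U := by linarith
  have hr0 : 0 < r := (div_pos hU hS).trans hr.1
  have hr' : U / r < U - 2 * starDist w off pt := by
    rw [div_lt_iff₀ hr0, mul_comm, ← div_lt_iff₀ hS]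
    exact hr.1
  have hLr : L ≤ U / r := by
    rw [le_div_iff₀ hr0, mul_comm, ← le_div_iff₀ hL]
    exact hr.2
  have hULe : L ≤ U := by linarith
  have hb : 0 ≤ 1 + ε := by linarith
  -- The advice never costs more than `U + 2β`, so consistency and the cost `L` per occupied unit
  -- give this bound on occupancy.
  obtain ⟨C, hCe⟩ : ∃ C, C = (1 + ε) * (U + 2 * starDist w off pt) / L := ⟨_, rfl⟩
  have hC : 0 ≤ C := by rw [hCe]; positivity
  suffices hN : ∀ N : ℕ, 0 < N → excess L U (starDist w off pt) r ≤ (1 + ε - 1) * L +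
      (r * (U / r - L + 2 * starDist w off pt) * rate L U (starDist w off pt) (U / r) +
      4 * (1 + rate L U (starDist w off pt) (U / r)) * (starDist w off pt * (C + 1)) +
      (1 + ε) * (2 * starDist w off pt)) / N by
    refine le_of_forall_pos_le_add fun η hη => ?_
    generalize r * (U / r - L + 2 * starDist w off pt) * rate L U (starDist w off pt) (U / r) +
      4 * (1 + rate L U (starDist w off pt) (U / r)) * (starDist w off pt * (C + 1)) +
      (1 + ε) * (2 * starDist w off pt) = E at hN
    obtain ⟨N, hNE⟩ := exists_nat_gt (E / η)
    refine (hN (N + 1) N.succ_pos).trans ?_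
    have : E / ((N + 1 : ℕ) : ℝ) ≤ η := by
      rw [div_le_iff₀ (by positivity), mul_comm]
      rw [div_lt_iff₀ hη] at hNE
      push_cast
      linarith
    linarith
  intro N hN
  have hN1 : (1 : ℝ) ≤ N := by exact_mod_cast hN
  obtain ⟨k, hk⟩ := exists_nat_gt (C / (1 / ((N ^ 2 : ℕ) * (1 + ((N ^ 2 : ℕ) : ℝ)) ^ N)))
  rw [div_lt_iff₀ (by positivity)] at hk
  obtain ⟨T₀, hT₀⟩ : ∃ T₀, T₀ = (N + 1) * (k * (N ^ 2 + N)) := ⟨_, rfl⟩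
  have hadv : ∀ p, Feasible (priceInstance off pt U (T₀ + N) p) (block off pt (T₀ + N) T₀ N) :=
    fun p => feasible_block hne U p hN le_rfl
  have hval : ∀ p, IsPrice L U p → IsValid off L U (priceInstance off pt U (T₀ + N) p) :=
    fun p hp => isValid_priceInstance hne hULe hp hN (by omega)
  obtain ⟨x, hx⟩ : ∃ x : (ℕ → ℝ) → Fin (T₀ + N) → X → ℝ, ∀ p, x p =
      A (priceInstance off pt U (T₀ + N) p) (block off pt (T₀ + N) T₀ N) := ⟨_, fun _ => rfl⟩
  have hfeas : ∀ p, IsPrice L U p → Feasible (priceInstance off pt U (T₀ + N) p) (x p) :=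
    fun p hp => hx p ▸ hA.feasible _ (hval p hp) _ (hadv p)
  have H := isReaction_trajectory hw hne hULe hA hN (by omega) _ hadv x hx
  have hbd := fun p hp => cost_priceInstance_bounds hw hne hL hULe hp (hfeas p hp) _ _ _ rfl rfl rfl
  refine H.excess_le hβ hN hr0 hr' hLr hC hk hT₀.symm.le ?_ ?_ ?_
  · intro p hp t ht hpU z hz s₀ hs₀ hpx
    have h1 := hrob _ (hval p hp) _ (hadv p)
    rw [← hx] at h1
    have hnn : ∀ c ∈ cost w off (priceInstance off pt U (T₀ + N) p) '' {z | Feasible _ z},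
        0 ≤ c := by
      rintro _ ⟨v, hv, rfl⟩
      refine le_trans (mul_nonneg hL.le (sum_nonneg fun s _ => ?_))
        (cost_priceInstance_bounds hw hne hL hULe hp hv _ _ _ rfl rfl rfl).2.2
      have hv' := isAllocation_trajectory (off := off) hv.1 (s + 1)
      have := single_le_sum (fun b _ => hv'.1 b) (mem_univ off)
      rw [hv'.2] at this
      exact sub_nonneg.2 this
    have h2 : opt w off (priceInstance off pt U (T₀ + N) p) ≤
        z + 2 * starDist w off pt / N := by
      refine csInf_le_of_le ⟨0, hnn⟩ ⟨_, feasible_block hne U p hN (s₀ := s₀) (by omega), rfl⟩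
        (cost_block_le hw hne U hN (by omega) hpx)
    have h0 : 0 ≤ opt w off (priceInstance off pt U (T₀ + N) p) := Real.sInf_nonneg hnn
    have h3 := mul_le_mul_of_nonneg_left h2 hr0.le
    -- Since the optimum is nonnegative, `r₀`-robustness implies `r`-robustness.
    have h5 := mul_le_mul_of_nonneg_right hr₀ h0
    have h4 := netGain_anti (a := fun s => trajectory off (x p) s pt)
      (φ := fun s => ∑ a, starPotential w off pt a * trajectory off (x p) s a)
      (show t ≤ T₀ + N by omega) hpU
    linarith [(hbd p hp).1]
  · intro p hp t ht
    have h1 := hcons _ (hval p hp) _ (hadv p)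
    rw [← hx] at h1
    have h2 := cost_block_le hw hne U (p := p) hN (le_refl (T₀ + N)) (x := U)
      fun s _ _ => (hp s).2
    have h3 : starDist w off pt / N ≤ starDist w off pt := div_le_self hβ hN1
    have h4 := mul_le_mul_of_nonneg_left
      (h2.trans (show U + 2 * starDist w off pt / N ≤ U + 2 * starDist w off pt by
        rw [mul_div_assoc]; linarith)) hb
    have h5 : occupancy (fun s => 1 - trajectory off (x p) s off) t ≤
        occupancy (fun s => 1 - trajectory off (x p) s off) (T₀ + N) :=
      sum_le_sum_of_subset_of_nonneg (range_mono (by omega))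
        fun s _ _ => (H.nonneg p _ hp).trans (H.le p _ hp)
    refine h5.trans ?_
    rw [hCe, le_div_iff₀ hL, mul_comm]
    exact (hbd p hp).2.2.trans (h1.trans h4)
  · intro p hp hpL t ht
    have h1 := hcons _ (hval p hp) _ (hadv p)
    rw [← hx] at h1
    have h2 := mul_le_mul_of_nonneg_left
      (cost_block_le hw hne U (p := p) hN (le_refl (T₀ + N)) (x := L) hpL) hb
    have h3 := netLoss_mono (φ := fun s => ∑ a, starPotential w off pt a * trajectory off (x p) s a)
      (show t ≤ T₀ + N by omega) hp fun s => H.nonneg p s hp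
    linarith [(hbd p hp).2.1]

end Algorithm

end MAL

theorem corollary4p5 {X : Type*} [Fintype X] [DecidableEq X]
    (w : X → ℝ) (hw : ∀ a, 0 ≤ w a) (off : X)
    (L U β ε : ℝ) (hL : 0 < L)
    (hβ : IsGreatest {s : ℝ | ∃ a, a ≠ off ∧ s = MAL.starDist w off a} β)
    (hβU : β < (U - L) / 2) (hε : 0 ≤ ε) :
    (∃! γ : ℝ, MAL.IsTargetRobustness L U β ε γ) ∧
    ∀ γ : ℝ, MAL.IsTargetRobustness L U β ε γ →
      ∀ A : MAL.Strategy X, MAL.IsOnlineAlgorithm off L U A →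
        MAL.IsConsistent w off L U A (1 + ε) →
        ∀ r : ℝ, MAL.IsRobust w off L U A r → γ ≤ r := by
  obtain ⟨⟨pt, hne, rfl⟩, -⟩ := hβ
  have hβ := MAL.starDist_nonneg hw off pt
  have hUL : 2 * MAL.starDist w off pt < U - L := by linarith
  refine ⟨MAL.existsUnique_isTargetRobustness hL hβ hUL hε,
    fun γ hγ A hA hcons r hrob => ?_⟩
  rw [MAL.isTargetRobustness_iff hL] at hγ
  by_contra! hlt
  -- The factor `r` may lie outside the interval on which `excess` is monotone, so a larger one
  -- below `γ` replaces it.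
  obtain ⟨r', h1, h2⟩ := exists_between (max_lt hγ.1.1 hlt)
  have hr' : r' ∈ Set.Ioc (U / (U - 2 * MAL.starDist w off pt)) (U / L) :=
    ⟨(le_max_left _ _).trans_lt h1, h2.le.trans hγ.1.2⟩
  have h3 := MAL.excess_le_of_isRobust hw hne hL hUL hA hε hcons hrob
    ((le_max_right _ _).trans h1.le) hr'
  have h4 := MAL.excess_strictAntiOn hL hβ hUL hr' hγ.1 h2
  linarith [hγ.2]
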